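/- **Theorem.** There is an algorithm which, given the structure constants $(c_{ijk})\in\mathbb{Q}^{9\times 9\times 9}$, $e_ie_j=\sum_k c_{ijk}e_k$, of any central simple algebra $A$ of degree 3 over $\mathbb{Q}$ (that is, $\dim_{\mathbb{Q}}A=9$) with respect to any basis $e_1,\dots,e_9$, terminates and outputs (in coordinates with respect to this basis) one of the following, together with the information which of the two it is: 1. a zero divisor $x\in A$, that is, an element $x\neq 0$ such that $xy=0$ or $yx=0$ for some $y\neq 0$ in $A$; or 2. two elements $a,b\in A$ that generate $A$ as a cyclic algebra $(E,\sigma,\beta)$ of degree 3, that is, $$A=\langle 1,a,a^2,\,b,ab,a^2b,\,b^2,ab^2,a^2b^2\rangle_{\mathbb{Q}},$$ where $E=\langle 1,a,a^2\rangle_{\mathbb{Q}}\subseteq A$ is a Galois field extension of $\mathbb{Q}$ of degree 3 with $\operatorname{Gal}(E|\mathbb{Q})=\langle\sigma\rangle$, and where $ba=\sigma(a)b$ and $b^3=\beta\cdot 1$ with $\beta\in\mathbb{Q}\setminus\{0\}$. Here $A$ is allowed to be a division algebra or to be split, that is, isomorphic to $M_3(\mathbb{Q})$; the algorithm is not told which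 is the case. -/

import Mathlib

/-- The names of rational numbers that an algorithm reads and writes:
numerator and denominator. -/
abbrev RatName : Type := ℤ × ℕ

/-- The canonical name of a rational number, in lowest terms. -/
def ratName (q : ℚ) : RatName := (q.num, q.den)

/-- The rational number with a given name, not necessarily in lowest terms. -/
def ratOfName (p : RatName) : ℚ := (p.1 : ℚ) / (p.2 : ℚ)

/-- Every rational number is recovered from its canonical name. -/
theorem ratOfName_ratName (q : ℚ) : ratOfName (ratName q) = q :=
  Rat.num_div_den q

/-- Input of the algorithm: a multiplication table for a basis of 9 elements, where the entry
`(i, j, k)` names the `k`-th coordinate of the product of the basis vectors `i` and `j`. -/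
abbrev StructureTable : Type := Fin 9 → Fin 9 → Fin 9 → RatName

/-- Names of elements of a 9-dimensional algebra: coordinates with respect to a basis. -/
abbrev ElementName : Type := Fin 9 → RatName

/-- Output of the algorithm: one element (announced as a zero divisor), or a pair of elements
(announced as the generators of a cyclic presentation). -/
abbrev SearchOutput : Type := ElementName ⊕ (ElementName × ElementName)

universe u

/-- The multiplication table of the algebra `A` with respect to the basis `e`. -/
noncomputable def structureTable {A : Type u} [Ring A] [Algebra ℚ A]
    (e : Module.Basis (Fin 9) ℚ A) : StructureTable :=
  fun i j k => ratName (e.repr (e i * e j) k)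

/-- The element of `A` with the named coordinates with respect to the basis `e`. -/
noncomputable def elementOfName {A : Type u} [Ring A] [Algebra ℚ A]
    (e : Module.Basis (Fin 9) ℚ A) (v : ElementName) : A :=
  ∑ i, ratOfName (v i) • e i

/-- A nonzero element that is a left or a right zero divisor
(the submonoid `nonZeroDivisors A` is the two-sided one). -/
def IsZeroDivisor {A : Type u} [Ring A] (x : A) : Prop :=
  x ≠ 0 ∧ x ∉ nonZeroDivisors A

/-- The elements `a, b` present `A` as the cyclic algebra `(E, σ, β)` of degree 3 over `ℚ`.
The field `E` is embedded in `A` by `ι` (injective once `A ≠ 0`), with image the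
`ℚ`-span of `1, a, a²`; the element of `E` corresponding to `a` is `α`. -/
structure IsCyclicPresentation {A : Type u} [Ring A] [Algebra ℚ A] (a b : A)
    (E : Type u) [Field E] [Algebra ℚ E] (ι : E →ₐ[ℚ] A) (σ : E ≃ₐ[ℚ] E) (β : ℚ) : Prop where
  span_eq_top : Submodule.span ℚ
    {1, a, a ^ 2, b, a * b, a ^ 2 * b, b ^ 2, a * b ^ 2, a ^ 2 * b ^ 2} = (⊤ : Submodule ℚ A)
  range_eq : LinearMap.range ι.toLinearMap = Submodule.span ℚ {1, a, a ^ 2}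
  degree_eq : Module.finrank ℚ E = 3
  isGalois : IsGalois ℚ E
  gal_eq : Subgroup.zpowers σ = ⊤
  mul_comm_rule : ∃ α : E, ι α = a ∧ b * a = ι (σ α) * b
  beta_ne_zero : β ≠ 0
  cube_eq : b ^ 3 = algebraMap ℚ A β

/-- The elements `a, b` generate `A` as a cyclic algebra `(E, σ, β)` of degree 3 over `ℚ`,
for some `E`, `σ` and `β`. -/
def GeneratesAsCyclicAlgebra {A : Type u} [Ring A] [Algebra ℚ A] (a b : A) : Prop :=
  ∃ (E : Type u) (_ : Field E) (_ : Algebra ℚ E) (ι : E →ₐ[ℚ] A) (σ : E ≃ₐ[ℚ] E) (β : ℚ),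
    IsCyclicPresentation a b E ι σ β

/-- The output, read in coordinates with respect to `e`, is correct: a single element is a zero
divisor, a pair of elements generates `A` as a cyclic algebra. -/
def SearchOutput.IsCorrect {A : Type u} [Ring A] [Algebra ℚ A]
    (e : Module.Basis (Fin 9) ℚ A) : SearchOutput → Prop
  | Sum.inl x => IsZeroDivisor (elementOfName e x)
  | Sum.inr (a, b) => GeneratesAsCyclicAlgebra (elementOfName e a) (elementOfName e b)

/-! The algorithm is an unbounded search through all integral certificates for one of the two
answers. Checking a certificate takes finitely many integer operations, so the search is partial
recursive (`partrec_searchCertificate`); what remains is that accepted certificates are right and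
that one always exists.

If `A` has zero divisors, clearing denominators in a pair with product zero gives a certificate.
Otherwise `A` is a division algebra, being finite-dimensional, and Wedderburn's theorem
(`exists_cyclic_generators`) applies. A root `x` of a depressed cubic has a conjugate `y` with `x² +
xy + y² = p`. Either `x` and `y` commute and the conjugating element has central cube, or the
commutator `xy - yx` has (`exists_cube_mem_bot`). Applying the same factorization to an element `b`
with central cube gives a conjugate `v * b`, and conjugation by `b⁻¹` maps the cubic field generated
by `v` to itself. As `ℚ` has no primitive cube root of unity, `v` is not a scalar, so `v` and `b⁻¹`
are the generators.

Conversely, the certified relations alone force a cyclic presentation of a 9-dimensional algebra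
(`generatesAsCyclicAlgebra_of_relations`), whether or not it is a division algebra. -/

/-! ### Primitive recursive integer arithmetic -/

namespace Primrec

theorem _root_.Int.encode_natCast (k : ℕ) : Encodable.encode (k : ℤ) = 2 * k :=
  (congrFun Equiv.natSumNatEquivNat_apply (Sum.inl k) :)

theorem _root_.Int.encode_negSucc (k : ℕ) : Encodable.encode (Int.negSucc k) = 2 * k + 1 :=
  (congrFun Equiv.natSumNatEquivNat_apply (Sum.inr k) :)

/-- The code of an integer is `2k` for `k` and `2k + 1` for `-(k + 1)`, so the code of a difference
is an explicit function of two naturals. Other operations reduce to this one by splitting an integer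
into positive and negative parts. -/
theorem int_subNat : Primrec₂ fun m n : ℕ => (m : ℤ) - n := by
  have h : Primrec fun p : ℕ × ℕ =>
      if p.2 ≤ p.1 then 2 * (p.1 - p.2) else 2 * (p.2 - p.1 - 1) + 1 := by
    refine Primrec.ite (Primrec.nat_le.comp snd fst) ?_ ?_
    · exact nat_mul.comp (const 2) (nat_sub.comp fst snd)
    · exact succ.comp (nat_mul.comp (const 2)
        (nat_sub.comp (nat_sub.comp snd fst) (const 1)))
  refine Primrec.encode_iff.1 (h.of_eq fun p => ?_)
  dsimp only
  split_ifs with hle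
  · rw [← Nat.cast_sub hle, Int.encode_natCast]
  · obtain ⟨k, hk⟩ := Nat.exists_eq_add_of_lt (not_le.1 hle)
    have : (p.1 : ℤ) - p.2 = Int.negSucc k := by
      rw [hk, Int.negSucc_eq]; push_cast; ring
    rw [this, Int.encode_negSucc, hk]
    omega

theorem int_toNat : Primrec Int.toNat := by
  have h : Primrec fun n : ℕ => if n % 2 = 0 then n / 2 else 0 :=
    Primrec.ite (Primrec.eq.comp (nat_mod.comp Primrec.id (const 2)) (const 0))
      (nat_div.comp Primrec.id (const 2)) (const 0)
  refine (h.comp Primrec.encode).of_eq fun z => ?_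
  cases z with
  | ofNat k => rw [Int.ofNat_eq_natCast, Int.encode_natCast]; simp
  | negSucc k => rw [Int.encode_negSucc]; simp

theorem int_neg_toNat : Primrec fun z : ℤ => (-z).toNat := by
  have h : Primrec fun n : ℕ => if n % 2 = 0 then 0 else n / 2 + 1 :=
    Primrec.ite (Primrec.eq.comp (nat_mod.comp Primrec.id (const 2)) (const 0))
      (const 0) (succ.comp (nat_div.comp Primrec.id (const 2)))
  refine (h.comp Primrec.encode).of_eq fun z => ?_
  cases z with
  | ofNat k => rw [Int.ofNat_eq_natCast, Int.encode_natCast]; simp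
  | negSucc k => rw [Int.encode_negSucc, Int.neg_negSucc]; simp; omega

variable {α : Type*} [Primcodable α] {f g : α → ℤ}

theorem int_add (hf : Primrec f) (hg : Primrec g) : Primrec fun x => f x + g x := by
  refine (int_subNat.comp (nat_add.comp (int_toNat.comp hf) (int_toNat.comp hg))
    (nat_add.comp (int_neg_toNat.comp hf) (int_neg_toNat.comp hg))).of_eq fun x => ?_
  have h₁ := Int.toNat_sub_toNat_neg (f x)
  have h₂ := Int.toNat_sub_toNat_neg (g x)
  push_cast
  linarith

theorem int_neg (hf : Primrec f) : Primrec fun x => -f x := by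
  refine (int_subNat.comp (int_neg_toNat.comp hf) (int_toNat.comp hf)).of_eq fun x => ?_
  have h₁ := Int.toNat_sub_toNat_neg (f x)
  linarith

theorem int_mul (hf : Primrec f) (hg : Primrec g) : Primrec fun x => f x * g x := by
  refine (int_subNat.comp
    (nat_add.comp (nat_mul.comp (int_toNat.comp hf) (int_toNat.comp hg))
      (nat_mul.comp (int_neg_toNat.comp hf) (int_neg_toNat.comp hg)))
    (nat_add.comp (nat_mul.comp (int_toNat.comp hf) (int_neg_toNat.comp hg))
      (nat_mul.comp (int_neg_toNat.comp hf) (int_toNat.comp hg)))).of_eq fun x => ?_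
  have h₁ := Int.toNat_sub_toNat_neg (f x)
  have h₂ := Int.toNat_sub_toNat_neg (g x)
  push_cast
  -- The first four occurrences lie inside `toNat`; only the factor on the right-hand side is to be
  -- split.
  nth_rewrite 5 [← h₁]
  nth_rewrite 5 [← h₂]
  ring

theorem int_natCast {f : α → ℕ} (hf : Primrec f) : Primrec fun x => (f x : ℤ) :=
  (int_subNat.comp hf (const 0)).of_eq fun x => by simp

theorem int_sum {ι : Type*} (s : Finset ι) {f : α → ι → ℤ} (hf : ∀ i, Primrec fun x => f x i) :
    Primrec fun x => ∑ i ∈ s, f x i := by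
  classical
  induction s using Finset.induction_on with
  | empty => simpa using const 0
  | insert i s hi ih => simpa [Finset.sum_insert hi] using int_add (hf i) ih

theorem fin_apply {β : Type*} [Primcodable β] {n : ℕ} {f : α → Fin n → β} (hf : Primrec f)
    (i : Fin n) : Primrec fun x => f x i :=
  fin_app.comp hf (const i)

theorem fin_pi {β : Type*} [Primcodable β] {n : ℕ} {f : α → Fin n → β}
    (hf : ∀ i, Primrec fun x => f x i) : Primrec f :=
  fin_curry.2 ((fin_curry₁.2 hf).comp snd fst)

end Primrec

theorem PrimrecPred.forall_fin {α : Type*} [Primcodable α] {n : ℕ} {p : α → Fin n → Prop}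
    (hp : ∀ i, PrimrecPred fun x => p x i) : PrimrecPred fun x => ∀ i, p x i := by
  induction n with
  | zero => exact (PrimrecPred.of_eq (Primrec.eq.comp (.const 0) (.const 0)) fun x => by simp)
  | succ n ih =>
    exact ((hp 0).and (ih fun i => hp i.succ)).of_eq fun x => by simp [Fin.forall_fin_succ]

/-! ### Central division algebras of degree three -/

section DegreeThree

variable {F D : Type*} [Field F] [DivisionRing D] [Algebra F D]

theorem Subalgebra.finrank_dvd_of_divisionRing [FiniteDimensional F D] (S : Subalgebra F D) :
    Module.finrank F S ∣ Module.finrank F D := by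
  let := divisionRingOfFiniteDimensional F S
  exact Module.finrank_dvd_finrank_right F S D

/-- A subalgebra is itself a division ring, so its dimension is 1, 3 or 9. The element `x` excludes
1, and the pair `y`, `z` excludes 9. -/
theorem Subalgebra.finrank_eq_three [Algebra.IsCentral F D] (hD : Module.finrank F D = 9)
    {S : Subalgebra F D} {x y z : D} (hx : x ∈ S) (hxb : x ∉ (⊥ : Subalgebra F D))
    (hyz : ∀ s ∈ S, Commute y s) (hne : ¬ Commute y z) : Module.finrank F S = 3 := by
  have : FiniteDimensional F D := .of_finrank_pos (by omega)
  have hdvd := S.finrank_dvd_of_divisionRing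
  rw [hD, show 9 = 3 ^ 2 from rfl, Nat.dvd_prime_pow Nat.prime_three] at hdvd
  obtain ⟨k, hk, hS⟩ := hdvd
  interval_cases k
  · rw [pow_zero] at hS
    rw [Subalgebra.eq_bot_of_finrank_one hS] at hx
    exact absurd hx hxb
  · simpa using hS
  · have : S = ⊤ := Algebra.toSubmodule_eq_top.1
      (Submodule.eq_top_of_finrank_eq (by rw [S.finrank_toSubmodule, hS, hD]; norm_num))
    exact absurd (hyz z (this ▸ Algebra.mem_top)) hne

theorem exists_not_commute [Algebra.IsCentral F D] {x : D} (hx : x ∉ (⊥ : Subalgebra F D)) :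
    ∃ t, ¬ Commute x t := by
  by_contra! h
  exact hx (Algebra.IsCentral.out (Subalgebra.mem_center_iff.2 fun t => (h t).eq.symm))

theorem finrank_adjoin_singleton_eq_three [Algebra.IsCentral F D]
    (hD : Module.finrank F D = 9) {x : D} (hx : x ∉ (⊥ : Subalgebra F D)) :
    Module.finrank F (Algebra.adjoin F {x}) = 3 := by
  obtain ⟨t, ht⟩ := exists_not_commute hx
  exact Subalgebra.finrank_eq_three hD (Algebra.self_mem_adjoin_singleton F x) hx
    (fun s hs => Algebra.commute_of_mem_adjoin_self hs) ht

/-- The field generated by `x` lies in the centralizer of `x`, and both have dimension 3, so they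
coincide. -/
theorem mem_adjoin_singleton_of_commute [Algebra.IsCentral F D] (hD : Module.finrank F D = 9)
    {x w : D} (hx : x ∉ (⊥ : Subalgebra F D)) (hw : Commute x w) :
    w ∈ Algebra.adjoin F {x} := by
  have : FiniteDimensional F D := .of_finrank_pos (by omega)
  obtain ⟨t, ht⟩ := exists_not_commute hx
  have hle : Algebra.adjoin F {x} ≤ Subalgebra.centralizer F {x} :=
    Algebra.adjoin_le fun y hy => by
      rw [Set.mem_singleton_iff.1 hy]
      exact Subalgebra.mem_centralizer_iff F |>.2 fun z hz => by rw [Set.mem_singleton_iff.1 hz]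
  have h3 : Module.finrank F (Subalgebra.centralizer F {x}) = 3 :=
    Subalgebra.finrank_eq_three hD (hle (Algebra.self_mem_adjoin_singleton F x)) hx
      (fun s hs => (Subalgebra.mem_centralizer_iff F).1 hs x rfl) ht
  have heq : Subalgebra.toSubmodule (Algebra.adjoin F {x}) =
      Subalgebra.toSubmodule (Subalgebra.centralizer F {x}) :=
    Submodule.eq_of_le_of_finrank_eq hle
      ((finrank_adjoin_singleton_eq_three hD hx).trans h3.symm)
  change w ∈ Subalgebra.toSubmodule (Algebra.adjoin F {x})
  rw [heq]
  exact (Subalgebra.mem_centralizer_iff F).2 fun z hz => by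
    rw [Set.mem_singleton_iff.1 hz]; exact hw.eq

theorem commute_of_commute_of_notMem_bot [Algebra.IsCentral F D]
    (hD : Module.finrank F D = 9) {w p q : D} (hw : w ∉ (⊥ : Subalgebra F D))
    (hp : Commute w p) (hq : Commute w q) : Commute p q :=
  Algebra.commute_of_mem_adjoin_singleton_of_commute (mem_adjoin_singleton_of_commute hD hw hq)
    hp.symm

/-- A quadratic relation would make the span of `1, x` closed under multiplication, although `x`
generates a subalgebra of dimension 3. -/
theorem sq_ne_of_notMem_bot [Algebra.IsCentral F D] (hD : Module.finrank F D = 9) {x : D}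
    (hx : x ∉ (⊥ : Subalgebra F D)) (r s : F) : x ^ 2 ≠ r • 1 + s • x := by
  intro h
  have key : ∀ w ∈ Algebra.adjoin F {x}, w ∈ Submodule.span F {1, x} := by
    intro w hw
    induction hw using Algebra.adjoin_induction with
    | mem y hy => exact Submodule.subset_span (by simp_all)
    | algebraMap c =>
      rw [Algebra.algebraMap_eq_smul_one]
      exact Submodule.smul_mem _ _ (Submodule.subset_span (by simp))
    | add y z _ _ hy hz => exact add_mem hy hz
    | mul y z _ _ hy hz =>
      obtain ⟨a, b, rfl⟩ := Submodule.mem_span_pair.1 hy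
      obtain ⟨c, d, rfl⟩ := Submodule.mem_span_pair.1 hz
      refine Submodule.mem_span_pair.2 ⟨a * c + b * d * r, a * d + b * c + b * d * s, ?_⟩
      have : (a • (1 : D) + b • x) * (c • 1 + d • x) =
          (a * c) • 1 + (a * d + b * c) • x + (b * d) • x ^ 2 := by
        simp only [add_mul, mul_add, smul_mul_smul_comm, mul_one, one_mul, sq]
        module
      rw [this, h]
      module
  have h2 : Module.finrank F (Submodule.span F {1, x}) ≤ 2 := by
    classical
    have := finrank_span_finset_le_card (R := F) ({1, x} : Finset D)
    rw [Set.finrank, Finset.coe_pair] at this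
    exact this.trans Finset.card_le_two
  have : FiniteDimensional F D := .of_finrank_pos (by omega)
  have h3 := Submodule.finrank_mono
    (show Subalgebra.toSubmodule (Algebra.adjoin F {x}) ≤ Submodule.span F {1, x} from key)
  rw [Subalgebra.finrank_toSubmodule, finrank_adjoin_singleton_eq_three hD hx] at h3
  omega

theorem exists_eq_of_mem_adjoin_singleton [Algebra.IsCentral F D]
    (hD : Module.finrank F D = 9) {x w : D} (hx : x ∉ (⊥ : Subalgebra F D))
    (hw : w ∈ Algebra.adjoin F {x}) :
    ∃ s₀ s₁ s₂ : F, w = s₀ • 1 + s₁ • x + s₂ • x ^ 2 := by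
  have hli : LinearIndependent F ![1, x, x ^ 2] := by
    rw [Fintype.linearIndependent_iff]
    intro g hg
    simp only [Fin.sum_univ_three, Matrix.cons_val] at hg
    have h2 : g 2 = 0 := by
      by_contra h
      refine sq_ne_of_notMem_bot hD hx (-(g 2)⁻¹ * g 0) (-(g 2)⁻¹ * g 1) ?_
      have : x ^ 2 = (g 2)⁻¹ • (g 2 • x ^ 2) := (inv_smul_smul₀ h _).symm
      rw [this, eq_neg_of_add_eq_zero_right hg]
      module
    have h1 : g 1 = 0 := by
      by_contra h
      refine hx (Algebra.mem_bot.2 ⟨-(g 1)⁻¹ * g 0, ?_⟩)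
      rw [h2, zero_smul, add_zero] at hg
      have : x = (g 1)⁻¹ • (g 1 • x) := (inv_smul_smul₀ h _).symm
      rw [this, eq_neg_of_add_eq_zero_right hg, Algebra.algebraMap_eq_smul_one]
      module
    have h0 : g 0 = 0 := by simpa [h1, h2] using hg
    simp [Fin.forall_fin_succ, h0, h1, h2]
  have : FiniteDimensional F D := .of_finrank_pos (by omega)
  have hle : Submodule.span F (Set.range ![1, x, x ^ 2]) ≤
      Subalgebra.toSubmodule (Algebra.adjoin F {x}) := by
    have hxm := Algebra.self_mem_adjoin_singleton F x
    rw [Submodule.span_le]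
    rintro _ ⟨i, rfl⟩
    fin_cases i
    · exact one_mem (Algebra.adjoin F {x})
    · exact hxm
    · exact pow_mem hxm 2
  have heq := Submodule.eq_of_le_of_finrank_eq hle (by
    rw [finrank_span_eq_card hli, Subalgebra.finrank_toSubmodule,
      finrank_adjoin_singleton_eq_three hD hx, Fintype.card_fin])
  have hw' : w ∈ Submodule.span F (Set.range ![1, x, x ^ 2]) := heq ▸ hw
  obtain ⟨c, rfl⟩ := (Submodule.mem_span_range_iff_exists_fun F).1 hw'
  exact ⟨c 0, c 1, c 2, by simp [Fin.sum_univ_three]⟩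

theorem exists_cubic [Algebra.IsCentral F D] (hD : Module.finrank F D = 9) {x : D}
    (hx : x ∉ (⊥ : Subalgebra F D)) : ∃ c₀ c₁ c₂ : F, x ^ 3 = c₀ • 1 + c₁ • x + c₂ • x ^ 2 :=
  exists_eq_of_mem_adjoin_singleton hD hx
    (pow_mem (Algebra.self_mem_adjoin_singleton F x) 3)

theorem exists_depressed_cubic [CharZero F] [Algebra.IsCentral F D]
    (hD : Module.finrank F D = 9) :
    ∃ x : D, x ∉ (⊥ : Subalgebra F D) ∧ ∃ p q : F, x ^ 3 = p • x + q • 1 := by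
  obtain ⟨y, hy⟩ : ∃ y : D, y ∉ (⊥ : Subalgebra F D) := by
    by_contra! h
    have := Subalgebra.bot_eq_top_iff_finrank_eq_one.1 (eq_top_iff.2 fun y _ => h y)
    omega
  obtain ⟨c₀, c₁, c₂, h⟩ := exists_cubic hD hy
  -- The shift by a third of the quadratic coefficient removes the quadratic term.
  refine ⟨y - (c₂ / 3) • 1, fun hm => hy ?_, c₁ + c₂ ^ 2 / 3,
    c₀ + c₁ * c₂ / 3 + 2 * c₂ ^ 3 / 27, ?_⟩
  · simpa using add_mem hm (Subalgebra.smul_mem ⊥ (one_mem (⊥ : Subalgebra F D)) (c₂ / 3))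
  · have : (y - (c₂ / 3) • 1) ^ 3 =
        y ^ 3 - c₂ • y ^ 2 + (c₂ ^ 2 / 3) • y - (c₂ ^ 3 / 27) • 1 := by
      simp only [pow_succ, pow_zero, one_mul, sub_mul, mul_sub, smul_mul_assoc, mul_smul_comm,
        mul_one]
      module
    rw [this, h]
    module

/-! ### Wedderburn's factorization of cubic polynomials -/

section Factorization

variable {P Q x y : D}

/-- The commutator with `t` is a derivation: applied to the cubic equation it gives `x²δ + xδx + δx²
= Pδ`, and `δ` is then cancelled on the right. -/
theorem conj_sq_add_mul_add_sq {t δ : D} (hP : ∀ w, Commute P w) (hQ : ∀ w, Commute Q w)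
    (hx : x ^ 3 = P * x + Q) (hδ : δ = t * x - x * t) (hδ0 : δ ≠ 0) :
    x ^ 2 + x * (δ * x * δ⁻¹) + (δ * x * δ⁻¹) ^ 2 = P := by
  have h : x * x * δ + x * δ * x + δ * x * x = P * δ := by
    have hPt := (hP t).eq
    have hQt := (hQ t).eq
    subst hδ
    linear_combination (norm := noncomm_ring) t * hx - hx * t - hPt * x - hQt
  have : P = (P * δ) * δ⁻¹ := by rw [mul_assoc, mul_inv_cancel₀ hδ0, mul_one]
  rw [this, ← h]
  simp only [add_mul, sq, mul_assoc, mul_inv_cancel₀ hδ0, mul_one, inv_mul_cancel_left₀ hδ0]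

/-- With `z = -x - y`, the cubic factors as `(X - z)(X - y)(X - x)` for a central variable `X`. The
products `zyx`, `xzy` and `yxz` all equal `Q`, and their differences are the first two identities;
the third is the sum of these. -/
theorem commutator_mul_cycle (hP : ∀ w, Commute P w) (hQ : ∀ w, Commute Q w) (hQ0 : Q ≠ 0)
    (hx : x ^ 3 = P * x + Q) (hxy : x ^ 2 + x * y + y ^ 2 = P) :
    let k := x * y - y * x
    k * x = y * k ∧ k * y = (-x - y) * k ∧ k * (-x - y) = x * k := by
  intro k
  obtain ⟨z, hz⟩ : ∃ z, z = -x - y := ⟨_, rfl⟩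
  rw [← hz]
  have hzyx : z * y * x = Q := by
    rw [hz]
    linear_combination (norm := noncomm_ring) hx - hxy * x
  have hxzy : x * z * y = Q := by
    rw [hz]
    linear_combination (norm := noncomm_ring) hx - x * hxy + (hP x).eq
  have hz0 : z ≠ 0 := by
    intro h
    rw [h] at hzyx
    simp at hzyx
    exact hQ0 hzyx.symm
  have hyxz : y * x * z = Q := by
    refine mul_left_cancel₀ hz0 ?_
    rw [← (hQ z).eq, ← hzyx]
    noncomm_ring
  have h1 : k * x = y * k := by
    rw [hz] at hyxz hzyx
    simp only [k]
    linear_combination (norm := noncomm_ring) hyxz - hzyx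
  have h2 : k * y = z * k := by
    rw [hz] at hxzy hzyx ⊢
    simp only [k]
    linear_combination (norm := noncomm_ring) hzyx - hxzy
  refine ⟨h1, h2, ?_⟩
  rw [hz] at h2 ⊢
  linear_combination (norm := noncomm_ring) -h1 - h2

end Factorization

/-! ### Elements with central cube and Wedderburn's theorem. -/

theorem mem_bot_of_commute_of_commute [Algebra.IsCentral F D] (hD : Module.finrank F D = 9)
    {w p q : D} (hpq : ¬ Commute p q) (hp : Commute w p) (hq : Commute w q) :
    w ∈ (⊥ : Subalgebra F D) := by
  by_contra h
  exact hpq (commute_of_commute_of_notMem_bot hD h hp hq)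

theorem commute_of_mem_bot {w : D} (hw : w ∈ (⊥ : Subalgebra F D)) (y : D) : Commute w y := by
  obtain ⟨c, rfl⟩ := Algebra.mem_bot.1 hw
  exact Algebra.commutes c y

/-- If `x` commutes with its conjugate by `δ`, then conjugation by `δ` permutes the three roots
of the minimal polynomial of `x` cyclically. -/
theorem commute_cube_of_commute_conj [Algebra.IsCentral F D] (hD : Module.finrank F D = 9)
    {P Q x δ : D} (hP : ∀ w, Commute P w) (hQ : ∀ w, Commute Q w) (hx : x ^ 3 = P * x + Q)
    (hδ : ¬ Commute δ x) (hxy : x ^ 2 + x * (δ * x * δ⁻¹) + (δ * x * δ⁻¹) ^ 2 = P)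
    (hcomm : Commute x (δ * x * δ⁻¹)) : Commute (δ ^ 3) x := by
  have hδ0 : δ ≠ 0 := by rintro rfl; exact hδ (Commute.zero_left x)
  have hδb : δ ∉ (⊥ : Subalgebra F D) := fun h => hδ (commute_of_mem_bot h x)
  have hconj : ∀ {u v : D}, δ * u * δ⁻¹ = v → δ * u = v * δ := fun h => by
    rw [← h, inv_mul_cancel_right₀ hδ0]
  obtain ⟨y, hy⟩ : ∃ y, y = δ * x * δ⁻¹ := ⟨_, rfl⟩
  rw [← hy] at hxy hcomm
  have hyx := hconj hy.symm
  have hne : y ≠ x := by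
    rintro rfl
    exact hδ hyx
  obtain ⟨z, hz⟩ : ∃ z, z = δ * y * δ⁻¹ := ⟨_, rfl⟩
  have hzy := hconj hz.symm
  have hyb : y ∉ (⊥ : Subalgebra F D) := by
    intro h
    obtain ⟨c, hc⟩ := Algebra.mem_bot.1 h
    rw [← hc, Algebra.commutes] at hyx
    exact hne ((mul_left_cancel₀ hδ0 hyx).trans hc).symm
  have hyz : Commute y z := by
    have h1 : SemiconjBy δ x y := hyx
    have h2 : SemiconjBy δ y z := hzy
    have h3 := (h1.mul_right h2).eq
    rw [hcomm.eq, (h2.mul_right h1).eq] at h3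
    exact (mul_right_cancel₀ hδ0 h3).symm
  have hxz : Commute x z := commute_of_commute_of_notMem_bot hD hyb hcomm.symm hyz
  have hz3 : z ^ 3 = P * z + Q := by
    have h1 : SemiconjBy δ x y := hyx
    have h2 : SemiconjBy δ y z := hzy
    have h : SemiconjBy (δ ^ 2) x z := sq δ ▸ h2.mul_left h1
    have hPQ : SemiconjBy (δ ^ 2) (P * x + Q) (P * z + Q) :=
      ((show SemiconjBy (δ ^ 2) P P from (hP _).symm).mul_right h).add_right (hQ _).symm
    refine mul_right_cancel₀ (pow_ne_zero 2 hδ0) ?_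
    rw [← (h.pow_right 3).eq, hx, hPQ.eq]
  -- In commuting elements the cubic with roots `x` and `y` has third root `-x - y`. Of the three
  -- factors, `z = x` would make `δ ^ 2` a scalar and `z = y` would give `y = x`, so `z = -x - y`
  -- remains.
  have hroot : (z - x) * ((z - y) * (z + x + y)) = 0 := by
    have hexp : (z - x) * ((z - y) * (z + x + y)) = z ^ 3 - (P * z + (x ^ 3 - P * x)) := by
      rw [← hxy]
      simp only [pow_succ, pow_zero, one_mul, mul_add, add_mul, sub_mul, mul_sub, mul_assoc,
        hcomm.symm.eq, hcomm.symm.left_comm, hxz.symm.eq, hxz.symm.left_comm, hyz.symm.eq,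
        hyz.symm.left_comm]
      abel
    rw [hexp, hz3, hx]
    abel
  rcases mul_eq_zero.1 hroot with h | h
  · have hzx := sub_eq_zero.1 h
    have h2 : Commute (δ ^ 2) x := by
      have h1 : SemiconjBy δ x y := hyx
      have h2 : SemiconjBy δ y x := hzx ▸ hzy
      rw [sq]
      exact h2.mul_left h1
    have hb := mem_bot_of_commute_of_commute hD hδ ((Commute.refl δ).pow_left 2) h2
    obtain ⟨c, hc⟩ := Algebra.mem_bot.1 hb
    refine absurd ?_ (sq_ne_of_notMem_bot hD hδb c 0)
    rw [← hc, Algebra.algebraMap_eq_smul_one, zero_smul, add_zero]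
  rcases mul_eq_zero.1 h with h | h
  · have hzy' := sub_eq_zero.1 h
    rw [hzy', hyx.symm] at hzy
    exact absurd (mul_left_cancel₀ hδ0 hzy) hne
  · have h1 : SemiconjBy δ x y := hyx
    have h2 : SemiconjBy δ y z := hzy
    have h3 : SemiconjBy δ z x := by
      have hz' : z = -(x + y) := by linear_combination (norm := abel) h
      have : x = -(y + z) := by rw [hz']; abel
      have h4 := (h1.add_right h2).neg_right
      rwa [← hz', ← this] at h4
    rw [pow_succ, sq]
    exact (h3.mul_left h2).mul_left h1

/-- An element cycling `x → y → -x - y → x` by conjugation has a cube commuting with `x` and with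
itself, hence a scalar. That element is `δ` if `x` and `y` commute, and their commutator if not. -/
theorem exists_cube_mem_bot [CharZero F] [Algebra.IsCentral F D]
    (hD : Module.finrank F D = 9) :
    ∃ b : D, b ∉ (⊥ : Subalgebra F D) ∧ b ^ 3 ∈ (⊥ : Subalgebra F D) := by
  obtain ⟨x, hxb, p, q, hx⟩ := exists_depressed_cubic (F := F) (D := D) hD
  obtain ⟨t, ht⟩ := exists_not_commute hxb
  obtain ⟨δ, hδ⟩ : ∃ δ, δ = t * x - x * t := ⟨_, rfl⟩
  have hδ0 : δ ≠ 0 := by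
    rw [hδ, sub_ne_zero]
    exact fun h => ht h.symm
  have hP : ∀ w : D, Commute (algebraMap F D p) w := Algebra.commutes p
  have hQ : ∀ w : D, Commute (algebraMap F D q) w := Algebra.commutes q
  have hx' : x ^ 3 = algebraMap F D p * x + algebraMap F D q := by
    rw [hx, Algebra.smul_def, Algebra.algebraMap_eq_smul_one q]
  have hx0 : x ≠ 0 := by rintro rfl; exact hxb (zero_mem _)
  have hsq : ∀ c : F, x ^ 2 ≠ algebraMap F D c := fun c h =>
    sq_ne_of_notMem_bot hD hxb c 0 (by rw [h, Algebra.algebraMap_eq_smul_one]; simp)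
  have hQ0 : algebraMap F D q ≠ 0 := by
    intro h
    rw [h, add_zero, pow_succ] at hx'
    exact hsq p (mul_right_cancel₀ hx0 hx')
  have hxy := conj_sq_add_mul_add_sq hP hQ hx' hδ hδ0
  have hδx : ¬ Commute δ x := by
    intro h
    have : δ * x * δ⁻¹ = x := by rw [h.eq, mul_inv_cancel_right₀ hδ0]
    rw [this] at hxy
    refine hsq (p / 3) ?_
    have h3 : (3 : F) • x ^ 2 = algebraMap F D p := by
      rw [← hxy]
      rw [sq]
      module
    rw [div_eq_inv_mul, map_mul, ← h3, ← Algebra.smul_def, smul_smul,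
      inv_mul_cancel₀ three_ne_zero, one_smul]
  by_cases hc : Commute x (δ * x * δ⁻¹)
  · have h3 := commute_cube_of_commute_conj hD hP hQ hx' hδx hxy hc
    exact ⟨δ, fun h => hδx (commute_of_mem_bot h x),
      mem_bot_of_commute_of_commute hD hδx ((Commute.refl δ).pow_left 3) h3⟩
  · obtain ⟨h1, h2, h3⟩ := commutator_mul_cycle hP hQ hQ0 hx' hxy
    obtain ⟨y, hy⟩ : ∃ y, y = δ * x * δ⁻¹ := ⟨_, rfl⟩
    rw [← hy] at hc h1 h2 h3
    obtain ⟨k, hk⟩ : ∃ k, k = x * y - y * x := ⟨_, rfl⟩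
    rw [← hk] at h1 h2 h3
    have hk0 : k ≠ 0 := by
      rw [hk, sub_ne_zero]
      exact hc
    have hkx : ¬ Commute k x := by
      intro h
      have h4 := h.eq.symm.trans h1
      exact hc (by rw [mul_right_cancel₀ hk0 h4])
    refine ⟨k, fun h => hkx (commute_of_mem_bot h x),
      mem_bot_of_commute_of_commute hD hkx ((Commute.refl k).pow_left 3) ?_⟩
    have e1 : SemiconjBy k x y := h1
    have e2 : SemiconjBy k y (-x - y) := h2
    have e3 : SemiconjBy k (-x - y) x := h3
    rw [pow_succ, sq]
    exact (e3.mul_left e2).mul_left e1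

/-- **Wedderburn's theorem** on division algebras of degree three, in terms of generators. -/
theorem exists_cyclic_generators [CharZero F] [Algebra.IsCentral F D]
    (hD : Module.finrank F D = 9) (hF : ∀ c : F, c ^ 2 + c + 1 ≠ 0) :
    ∃ a b : D, a ∉ (⊥ : Subalgebra F D) ∧ b * a ≠ a * b ∧
      (∃ β : F, β ≠ 0 ∧ b ^ 3 = β • 1) ∧
      ∃ s₀ s₁ s₂ : F, b * a = (s₀ • 1 + s₁ • a + s₂ • a ^ 2) * b := by
  obtain ⟨b, hbb, hb3⟩ := exists_cube_mem_bot (F := F) (D := D) hD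
  obtain ⟨γ, hγ⟩ := Algebra.mem_bot.1 hb3
  have hb0 : b ≠ 0 := by rintro rfl; exact hbb (zero_mem _)
  have hγ0 : γ ≠ 0 := by
    rintro rfl
    rw [map_zero] at hγ
    exact pow_ne_zero 3 hb0 hγ.symm
  obtain ⟨t, ht⟩ := exists_not_commute hbb
  obtain ⟨δ, hδ⟩ : ∃ δ, δ = t * b - b * t := ⟨_, rfl⟩
  have hδ0 : δ ≠ 0 := by
    rw [hδ, sub_ne_zero]
    exact fun h => ht h.symm
  -- The factorization is now applied to `X³ - γ`; writing the conjugate of `b` as `v * b` turns it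
  -- into `v b v = -b (1 + v)`.
  have hxy := conj_sq_add_mul_add_sq (P := 0) (Q := algebraMap F D γ)
    (fun w => Commute.zero_left w) (Algebra.commutes γ) (by rw [hγ]; simp) hδ hδ0
  obtain ⟨v, hv⟩ : ∃ v, v = δ * b * δ⁻¹ * b⁻¹ := ⟨_, rfl⟩
  have hvb : δ * b * δ⁻¹ = v * b := by rw [hv, inv_mul_cancel_right₀ hb0]
  rw [hvb] at hxy
  have hv0 : v ≠ 0 := by
    rw [hv]
    simp [hδ0, hb0]
  have hrel : v * b * v = -b * (1 + v) := by
    refine mul_right_cancel₀ hb0 ?_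
    linear_combination (norm := noncomm_ring) hxy
  have hbot : v ∉ (⊥ : Subalgebra F D) := by
    intro h
    obtain ⟨c, rfl⟩ := Algebra.mem_bot.1 h
    refine hF c ?_
    have : algebraMap F D (c ^ 2 + c + 1) * b = 0 := by
      have hc := Algebra.commutes c b
      simp only [map_add, map_pow, map_one]
      linear_combination (norm := noncomm_ring) hrel + algebraMap F D c * hc + hc
    exact (map_eq_zero _).1 ((mul_eq_zero.1 this).resolve_right hb0)
  have hnc : ¬ Commute v b := by
    intro h
    refine sq_ne_of_notMem_bot hD hbot (-1) (-1) ?_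
    rw [h.eq] at hrel
    have h2 : v ^ 2 = -(1 + v) := by
      refine mul_left_cancel₀ hb0 ?_
      linear_combination (norm := noncomm_ring) hrel
    rw [h2]
    module
  -- This element is `b⁻¹ v b`; it commutes with `v` and so is a polynomial in `v`.
  have hw : (-(1 + v) * v⁻¹) ∈ Algebra.adjoin F {v} := by
    refine mem_adjoin_singleton_of_commute hD hbot ?_
    have h1 : Commute v (1 + v) := (Commute.one_right v).add_right (Commute.refl v)
    exact h1.neg_right.mul_right (Commute.refl v).inv_right₀
  obtain ⟨s₀, s₁, s₂, hs⟩ := exists_eq_of_mem_adjoin_singleton hD hbot hw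
  refine ⟨v, b⁻¹, hbot, ?_, ⟨γ⁻¹, inv_ne_zero hγ0, ?_⟩, s₀, s₁, s₂, ?_⟩
  · exact fun h => hnc ((Commute.inv_right_iff₀).1 (show v * b⁻¹ = b⁻¹ * v from h.symm))
  · rw [inv_pow, ← hγ, ← map_inv₀, Algebra.algebraMap_eq_smul_one]
  · rw [← hs]
    refine mul_right_cancel₀ hb0 (mul_left_cancel₀ hb0 (mul_right_cancel₀ hv0 ?_))
    simp only [mul_assoc, inv_mul_cancel₀ hb0, mul_inv_cancel_left₀ hb0, mul_one,
      inv_mul_cancel₀ hv0]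
    rw [← mul_assoc, hrel]
    noncomm_ring

end DegreeThree

/-! ### Recognizing cyclic algebras of degree three -/

section Recognition

open Polynomial

theorem exists_universal_cubic_extension {F : Type} {A : Type u} [Field F] [Ring A] [Algebra F A]
    {f : F[X]} (hf : Irreducible f) (hdeg : f.natDegree = 3) {a : A} (ha : aeval a f = 0) :
    ∃ (E : Type u) (_ : Field E) (_ : Algebra F E) (ι : E →ₐ[F] A) (α : E),
      ι α = a ∧ Module.finrank F E = 3 ∧ Submodule.span F {1, α, α ^ 2} = ⊤ ∧
      ∀ β : E, aeval β f = 0 → ∃ φ : E →ₐ[F] E, φ α = β := by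
  have : Fact (Irreducible f) := ⟨hf⟩
  let pb := AdjoinRoot.powerBasis hf.ne_zero
  have hdim : pb.dim = 3 := hdeg
  let e : ULift.{u} (AdjoinRoot f) ≃ₐ[F] AdjoinRoot f := ULift.algEquiv
  let ι₀ : AdjoinRoot f →ₐ[F] A := Ideal.Quotient.liftₐ _ (aeval a) fun g hg => by
    obtain ⟨h, rfl⟩ := Ideal.mem_span_singleton.1 hg
    rw [map_mul, ha, zero_mul]
  have hι₀ : ι₀ (AdjoinRoot.root f) = a := by
    change aeval a X = a
    exact aeval_X a
  have hspan : Submodule.span F {1, AdjoinRoot.root f, AdjoinRoot.root f ^ 2} = ⊤ := by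
    rw [eq_top_iff, ← pb.basis.span_eq]
    refine Submodule.span_mono ?_
    rintro _ ⟨i, rfl⟩
    rw [pb.basis_eq_pow, show pb.gen = AdjoinRoot.root f from AdjoinRoot.powerBasis_gen hf.ne_zero]
    obtain ⟨i, hi⟩ := i
    rw [hdim] at hi
    interval_cases i <;> simp
  -- The field is lifted to the universe of `A`, where a cyclic presentation expects it.
  refine ⟨ULift.{u} (AdjoinRoot f), inferInstance, inferInstance, ι₀.comp e.toAlgHom,
    e.symm (AdjoinRoot.root f), ?_, ?_, ?_, ?_⟩
  · simp [hι₀]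
  · rw [e.toLinearEquiv.finrank_eq, pb.finrank, hdim]
  · have := congrArg (Submodule.map e.symm.toLinearMap) hspan
    rw [Submodule.map_span, Submodule.map_top, LinearMap.range_eq_top.2 e.symm.surjective] at this
    simpa [Set.image_insert_eq] using this
  · intro β hβ
    have h0 : aeval (e β) f = 0 := by
      rw [← AlgEquiv.coe_toAlgHom, aeval_algHom_apply, hβ, map_zero]
    refine ⟨(e.symm.toAlgHom.comp (AdjoinRoot.liftAlgHom f (Algebra.ofId F _) (e β) h0)).comp
      e.toAlgHom, ?_⟩
    change e.symm (AdjoinRoot.liftAlgHom f _ (e β) h0 (e (e.symm (AdjoinRoot.root f)))) = β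
    rw [e.apply_symm_apply]
    exact (congrArg e.symm (AdjoinRoot.liftAlgHom_root ..)).trans (e.symm_apply_apply β)

/-- By Artin, the order of `σ` is the degree over its fixed field, so it divides 3. There are at
most 3 automorphisms, so the powers of `σ` exhaust them. -/
theorem isGalois_and_zpowers_eq_top_of_finrank_eq_three {F E : Type*} [Field F] [Field E]
    [Algebra F E] (h3 : Module.finrank F E = 3) {σ : E ≃ₐ[F] E} (hσ : σ ≠ 1) :
    IsGalois F E ∧ Subgroup.zpowers σ = ⊤ ∧ orderOf σ = 3 := by
  have : FiniteDimensional F E := .of_finrank_pos (by omega)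
  have hmul := Module.finrank_mul_finrank F
    (IntermediateField.fixedField (Subgroup.zpowers σ)) E
  rw [IntermediateField.finrank_fixedField_eq_card, h3] at hmul
  have hcard : Nat.card (Subgroup.zpowers σ) = 3 := by
    refine ((Nat.dvd_prime Nat.prime_three).1 (Dvd.intro_left _ hmul)).resolve_left fun h => ?_
    rw [Nat.card_zpowers, orderOf_eq_one_iff] at h
    exact hσ h
  have hle : Nat.card (E ≃ₐ[F] E) ≤ 3 := by
    rw [← h3, Nat.card_eq_fintype_card]
    exact AlgEquiv.card_le
  have hle' := Subgroup.card_le_card_group (Subgroup.zpowers σ)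
  refine ⟨IsGalois.of_card_aut_eq_finrank F E (by omega),
    Subgroup.eq_top_of_card_eq _ (by omega), by rw [← hcard, Nat.card_zpowers]⟩

theorem generatesAsCyclicAlgebra_of_relations {A : Type u} [Ring A] [Algebra ℚ A]
    (hA : Module.finrank ℚ A = 9) {a b : A} {f : ℚ[X]} (hf : Irreducible f)
    (hdeg : f.natDegree = 3) (ha : aeval a f = 0) (hba : b * a ≠ a * b) {β : ℚ} (hβ : β ≠ 0)
    (hb : b ^ 3 = β • 1) {s₀ s₁ s₂ : ℚ}
    (hs : b * a = (s₀ • 1 + s₁ • a + s₂ • a ^ 2) * b) : GeneratesAsCyclicAlgebra a b := by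
  have hnt : Nontrivial A := ⟨⟨_, _, hba⟩⟩
  have hfin : FiniteDimensional ℚ A := .of_finrank_pos (by omega)
  have hub : IsUnit b := by
    rw [← isUnit_pow_iff three_ne_zero, hb, ← Algebra.algebraMap_eq_smul_one]
    exact hβ.isUnit.map _
  obtain ⟨E, _, _, ι, α, rfl, hE3, hspan, huniv⟩ :=
    exists_universal_cubic_extension hf hdeg ha
  have hι : Function.Injective ι := ι.toRingHom.injective
  have hfinE : FiniteDimensional ℚ E := .of_finrank_pos (by omega)
  obtain ⟨α', hα'⟩ : ∃ α', α' = s₀ • 1 + s₁ • α + s₂ • α ^ 2 := ⟨_, rfl⟩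
  have hs' : SemiconjBy b (ι α) (ι α') := by
    simpa [SemiconjBy, hα'] using hs
  have hpoly : ∀ g : ℚ[X], SemiconjBy b (aeval (ι α) g) (aeval (ι α') g) := by
    intro g
    induction g using Polynomial.induction_on' with
    | add p q hp hq => simpa using hp.add_right hq
    | monomial n c =>
      rw [aeval_monomial, aeval_monomial]
      exact SemiconjBy.mul_right (Algebra.commutes c b).symm (hs'.pow_right n)
  -- Conjugation by the unit `b` carries `f(a) = 0` to the image of `α'`, so `α ↦ α'` defines an
  -- endomorphism of `E`.
  have hroot : aeval α' f = 0 := by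
    refine hι (hub.mul_left_injective ?_)
    have := (hpoly f).eq
    rw [ha, mul_zero] at this
    simp only [← aeval_algHom_apply, ← this, map_zero, zero_mul]
  obtain ⟨φ, hφ⟩ := huniv α' hroot
  let σ : E ≃ₐ[ℚ] E := AlgEquiv.ofBijective φ (Algebra.IsAlgebraic.algHom_bijective φ)
  have hσα : σ α = α' := hφ
  have hne : σ α ≠ α := by
    intro h
    rw [← hσα, h] at hs'
    exact hba hs'.eq
  have hrule : ∀ x : E, b * ι x = ι (σ x) * b := by
    intro x
    have hx : x ∈ Submodule.span ℚ {1, α, α ^ 2} := hspan ▸ Submodule.mem_top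
    induction hx using Submodule.span_induction with
    | mem y hy =>
      rcases hy with rfl | rfl | rfl
      · simp
      · rw [hσα]; exact hs'.eq
      · rw [map_pow, map_pow, map_pow, hσα]; exact (hs'.pow_right 2).eq
    | zero => simp
    | add y z _ _ hy hz => simp only [map_add, mul_add, add_mul, hy, hz]
    | smul c y _ hy => simp only [map_smul, mul_smul_comm, smul_mul_assoc, hy]
  obtain ⟨hgal, htop, hord⟩ := isGalois_and_zpowers_eq_top_of_finrank_eq_three hE3
    (σ := σ) (by rintro h; exact hne (by rw [h]; rfl))
  have hne2 : σ (σ α) ≠ α := by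
    intro h
    have h1 : (σ * σ).toLinearMap = (1 : E ≃ₐ[ℚ] E).toLinearMap := by
      refine LinearMap.ext_on hspan ?_
      rintro _ (rfl | rfl | rfl) <;> simp [h]
    have h2 : σ ^ 2 = 1 := by
      rw [sq]
      exact AlgEquiv.ext fun x => LinearMap.congr_fun h1 x
    have := orderOf_dvd_of_pow_eq_one h2
    rw [hord] at this
    omega
  let Φ : E × E × E →ₗ[ℚ] A :=
    ι.toLinearMap.coprod ((LinearMap.mulRight ℚ b ∘ₗ ι.toLinearMap).coprod
      (LinearMap.mulRight ℚ (b ^ 2) ∘ₗ ι.toLinearMap))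
  have hΦ : ∀ x y z, Φ (x, y, z) = ι x + (ι y * b + ι z * b ^ 2) := fun x y z => rfl
  have hΦinj : Function.Injective Φ := by
    rw [injective_iff_map_eq_zero]
    rintro ⟨x, y, z⟩ h
    rw [hΦ] at h
    -- As in Dedekind's independence of characters, the commutator with `a` eliminates `x`; after
    -- cancelling `b`, a second commutator eliminates `y`. The factors left over are nonzero because
    -- `α` is moved by `σ` and `σ²`.
    have h1 : ι (y * (σ α - α)) + ι (z * (σ (σ α) - α)) * b = 0 := by
      refine hub.mul_left_injective ?_
      have e1 := hrule α
      have e2 := hrule (σ α)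
      have c1 : ι x * ι α = ι α * ι x := by rw [← map_mul, mul_comm, map_mul]
      have c2 : ι y * ι α = ι α * ι y := by rw [← map_mul, mul_comm, map_mul]
      have c3 : ι z * ι α = ι α * ι z := by rw [← map_mul, mul_comm, map_mul]
      simp only [map_mul, map_sub]
      linear_combination (norm := noncomm_ring) h * ι α - ι α * h - c1 - c2 * b - c3 * b ^ 2
        - ι y * e1 - ι z * b * e1 - ι z * e2 * b
    have h2 : ι (z * (σ (σ α) - α) * (σ α - α)) = 0 := by
      refine hub.mul_left_injective ?_
      have e1 := hrule α
      have c1 : ι (y * (σ α - α)) * ι α = ι α * ι (y * (σ α - α)) := by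
        rw [← map_mul, mul_comm, map_mul]
      have c2 : ι (z * (σ (σ α) - α)) * ι α = ι α * ι (z * (σ (σ α) - α)) := by
        rw [← map_mul, mul_comm, map_mul]
      rw [map_mul, map_sub ι (σ α)]
      linear_combination (norm := noncomm_ring) h1 * ι α - ι α * h1 - c1 - c2 * b
        - ι (z * (σ (σ α) - α)) * e1
    have hz : z = 0 := by
      have := (map_eq_zero_iff ι hι).1 h2
      simpa [sub_eq_zero, hne, hne2] using this
    have hy : y = 0 := by
      rw [hz, zero_mul, map_zero, zero_mul, add_zero] at h1
      have := (map_eq_zero_iff ι hι).1 h1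
      simpa [sub_eq_zero, hne] using this
    have hx : x = 0 := by
      rw [hy, hz] at h
      simpa [map_eq_zero_iff ι hι] using h
    rw [hx, hy, hz]
    rfl
  have hΦsurj : Function.Surjective Φ := by
    refine (LinearMap.injective_iff_surjective_of_finrank_eq_finrank ?_).1 hΦinj
    rw [Module.finrank_prod, Module.finrank_prod, hE3, hA]
  have hrange : LinearMap.range ι.toLinearMap = Submodule.span ℚ {1, ι α, ι α ^ 2} := by
    rw [← Submodule.map_top, ← hspan, Submodule.map_span]
    simp [Set.image_insert_eq]
  refine ⟨E, inferInstance, inferInstance, ι, σ, β, ?_, hrange, hE3, hgal, htop,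
    ⟨α, rfl, hrule α⟩, hβ, by rw [hb, Algebra.algebraMap_eq_smul_one]⟩
  rw [eq_top_iff]
  rintro w -
  obtain ⟨⟨x, y, z⟩, rfl⟩ := hΦsurj w
  rw [hΦ]
  have hmem : ∀ (x : E) (c : A), ι x * c ∈ Submodule.span ℚ {c, ι α * c, ι α ^ 2 * c} := by
    intro x c
    have h1 : ι x ∈ Submodule.span ℚ {1, ι α, ι α ^ 2} := hrange ▸ ⟨x, rfl⟩
    have h2 := Submodule.mem_map_of_mem (f := LinearMap.mulRight ℚ c) h1
    rw [Submodule.map_span] at h2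
    simpa [Set.image_insert_eq] using h2
  refine add_mem ?_ (add_mem ?_ ?_)
  · rw [← mul_one (ι x)]
    refine Submodule.span_mono ?_ (hmem x 1)
    rintro _ (rfl | rfl | rfl) <;> simp
  · refine Submodule.span_mono ?_ (hmem y b)
    rintro _ (rfl | rfl | rfl) <;> simp
  · refine Submodule.span_mono ?_ (hmem z (b ^ 2))
    rintro _ (rfl | rfl | rfl) <;> simp

end Recognition

/-! ### The search algorithm -/

/-- Integral coordinate vectors in an algebra of dimension nine. -/
abbrev IntVector : Type := Fin 9 → ℤ

/-- Integral multiplication tables of algebras of dimension nine. -/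
abbrev IntTable : Type := Fin 9 → Fin 9 → Fin 9 → ℤ

/-- The product of two coordinate vectors with respect to a multiplication table. -/
def IntTable.mul (m : IntTable) (x y : IntVector) : IntVector :=
  fun k => ∑ i, ∑ j, m i j k * (x i * y j)

/-- `m` is the multiplication table of `D • e`, where `t` is the one of the basis `e`. -/
def IsScaledTable (t : StructureTable) (D : ℤ) (m : IntTable) : Prop :=
  D ≠ 0 ∧ ∀ i j k, m i j k * (t i j k).2 = D * (t i j k).1

/-- The vectors `x` and `y` are nonzero with product zero. -/
def IntTable.IsZeroDivisorPair (m : IntTable) (x y : IntVector) : Prop :=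
  x ≠ 0 ∧ y ≠ 0 ∧ m.mul x y = 0

/-- The value at `z` of the monic cubic polynomial that expresses `z ^ 3` by lower powers. -/
def cubicValue (c₀ c₁ c₂ z : ℤ) : ℤ := z * (z * z) + -(c₂ * (z * z) + (c₁ * z + c₀))

/-- A decidable form of the absence of integral roots, by divisibility of `c₀`. -/
def HasNoSmallRoot (c₀ c₁ c₂ : ℤ) : Prop :=
  ∀ n ∈ List.range (c₀.toNat + (-c₀).toNat + 1),
    cubicValue c₀ c₁ c₂ n ≠ 0 ∧ cubicValue c₀ c₁ c₂ (-n) ≠ 0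

/-- The coefficients in a certificate for a cyclic presentation: `n` times the unit of the algebra
has integral coordinates, the generator `a` is a root of `X³ - c₂X² - c₁X - c₀`, the cube of the
generator `b` is `β`, and `b * a = s(a) * b` with `s = (s₀ + s₁X + s₂X²) / d`. -/
abbrev CyclicCoefficients : Type := (ℤ × ℤ × ℤ × ℤ) × (ℤ × ℤ × ℤ × ℤ × ℤ)

/-- The relations that certify a cyclic presentation with generators `a` and `b`; the vector `u`
represents `n` times the unit. -/
def IntTable.IsCyclicCertificate (m : IntTable) (a b u : IntVector) :
    CyclicCoefficients → Prop
  | ((n, c₀, c₁, c₂), (β, d, s₀, s₁, s₂)) =>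
    (n ≠ 0 ∧ ∀ i, m.mul u (Pi.single i 1) = n • Pi.single i 1) ∧
    (n • m.mul a (m.mul a a) = c₀ • u + (n * c₁) • a + (n * c₂) • m.mul a a ∧
      HasNoSmallRoot c₀ c₁ c₂) ∧
    (β ≠ 0 ∧ n • m.mul b (m.mul b b) = β • u) ∧
    (m.mul b a ≠ m.mul a b ∧ d ≠ 0 ∧
      (n * d) • m.mul b a = m.mul (s₀ • u + (n * s₁) • a + (n * s₂) • m.mul a a) b)

/-- Candidates for a scaled table, three vectors and the coefficients of a certificate. -/
abbrev Certificate : Type :=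
  (ℤ × IntTable) × (IntVector × IntVector × IntVector) × CyclicCoefficients

/-- The element name of `D` times an integral coordinate vector. -/
def scaledName (D : ℤ) (x : IntVector) : ElementName := fun i => (D * x i, 1)

open Classical in
/-- The output confirmed by a certificate, if any. -/
noncomputable def Certificate.output (t : StructureTable) (w : Certificate) :
    Option SearchOutput :=
  if IsScaledTable t w.1.1 w.1.2 ∧ w.1.2.IsZeroDivisorPair w.2.1.1 w.2.1.2.1 then
    some (Sum.inl (scaledName w.1.1 w.2.1.1))
  else if IsScaledTable t w.1.1 w.1.2 ∧
      w.1.2.IsCyclicCertificate w.2.1.1 w.2.1.2.1 w.2.1.2.2 w.2.2 then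
    some (Sum.inr (scaledName w.1.1 w.2.1.1, scaledName w.1.1 w.2.1.2.1))
  else none

/-- The certificate with a given code number. -/
def decodeCertificate (n : ℕ) : Option Certificate :=
  @Encodable.decode Certificate Primcodable.toEncodable n

/-- Search through all certificates. -/
noncomputable def searchCertificate (t : StructureTable) : Part SearchOutput :=
  Nat.rfindOpt fun n => (decodeCertificate n).bind (Certificate.output t)

/-! ### Primitive recursiveness of the certificate check. -/

section Computability

open Primrec

variable {α : Type*} [Primcodable α]

theorem Primrec.int_smul {n : ℕ} {c : α → ℤ} {f : α → Fin n → ℤ} (hc : Primrec c)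
    (hf : Primrec f) : Primrec fun x => c x • f x :=
  fin_pi fun i => (int_mul hc (fin_apply hf i)).of_eq fun _ => rfl

theorem Primrec.int_vec_add {n : ℕ} {f g : α → Fin n → ℤ} (hf : Primrec f) (hg : Primrec g) :
    Primrec fun x => f x + g x :=
  fin_pi fun i => (int_add (fin_apply hf i) (fin_apply hg i)).of_eq fun _ => rfl

theorem Primrec.intTable_mul {m : α → IntTable} {x y : α → IntVector} (hm : Primrec m)
    (hx : Primrec x) (hy : Primrec y) : Primrec fun w => (m w).mul (x w) (y w) :=
  fin_pi fun k => int_sum _ fun i => int_sum _ fun j =>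
    int_mul (fin_apply (fin_apply (fin_apply hm i) j) k)
      (int_mul (fin_apply hx i) (fin_apply hy j))

theorem PrimrecPred.ne {β : Type*} [Primcodable β] {f g : α → β} (hf : Primrec f)
    (hg : Primrec g) : PrimrecPred fun x => f x ≠ g x :=
  (Primrec.eq.comp hf hg).not

theorem PrimrecPred.isScaledTable {t : α → StructureTable} {D : α → ℤ} {m : α → IntTable}
    (ht : Primrec t) (hD : Primrec D) (hm : Primrec m) :
    PrimrecPred fun w => IsScaledTable (t w) (D w) (m w) := by
  refine (PrimrecPred.ne hD (const 0)).and
    (PrimrecPred.forall_fin fun i => PrimrecPred.forall_fin fun j =>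
      PrimrecPred.forall_fin fun k => ?_)
  have htk := fin_apply (fin_apply (fin_apply ht i) j) k
  exact Primrec.eq.comp
    (int_mul (fin_apply (fin_apply (fin_apply hm i) j) k) (int_natCast (snd.comp htk)))
    (int_mul hD (fst.comp htk))

theorem PrimrecPred.isZeroDivisorPair {m : α → IntTable} {x y : α → IntVector}
    (hm : Primrec m) (hx : Primrec x) (hy : Primrec y) :
    PrimrecPred fun w => (m w).IsZeroDivisorPair (x w) (y w) :=
  (PrimrecPred.ne hx (const 0)).and ((PrimrecPred.ne hy (const 0)).and
    (Primrec.eq.comp (intTable_mul hm hx hy) (const 0)))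

theorem Primrec.cubicValue {c₀ c₁ c₂ z : α → ℤ} (h₀ : Primrec c₀) (h₁ : Primrec c₁)
    (h₂ : Primrec c₂) (hz : Primrec z) :
    Primrec fun w => cubicValue (c₀ w) (c₁ w) (c₂ w) (z w) :=
  int_add (int_mul hz (int_mul hz hz)) (int_neg
    (int_add (int_mul h₂ (int_mul hz hz)) (int_add (int_mul h₁ hz) h₀)))

theorem PrimrecPred.hasNoSmallRoot {c₀ c₁ c₂ : α → ℤ} (h₀ : Primrec c₀) (h₁ : Primrec c₁)
    (h₂ : Primrec c₂) : PrimrecPred fun w => HasNoSmallRoot (c₀ w) (c₁ w) (c₂ w) := by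
  have hR : PrimrecRel fun (n : ℕ) (w : α) =>
      _root_.cubicValue (c₀ w) (c₁ w) (c₂ w) n ≠ 0 ∧
      _root_.cubicValue (c₀ w) (c₁ w) (c₂ w) (-n) ≠ 0 := by
    have hn : Primrec fun p : ℕ × α => (p.1 : ℤ) := int_natCast fst
    exact (PrimrecPred.ne (Primrec.cubicValue (h₀.comp snd) (h₁.comp snd) (h₂.comp snd) hn)
      (const 0)).and (PrimrecPred.ne (Primrec.cubicValue (h₀.comp snd) (h₁.comp snd)
        (h₂.comp snd) (int_neg hn)) (const 0))
  exact hR.forall_mem_list.comp (list_range.comp (succ.comp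
    (nat_add.comp (int_toNat.comp h₀) (int_neg_toNat.comp h₀)))) Primrec.id

theorem PrimrecPred.isCyclicCertificate {m : α → IntTable} {a b u : α → IntVector}
    {c : α → CyclicCoefficients} (hm : Primrec m) (ha : Primrec a) (hb : Primrec b)
    (hu : Primrec u) (hc : Primrec c) :
    PrimrecPred fun w => (m w).IsCyclicCertificate (a w) (b w) (u w) (c w) := by
  have hn := fst.comp (fst.comp hc)
  have hc₀ := fst.comp (snd.comp (fst.comp hc))
  have hc₁ := fst.comp (snd.comp (snd.comp (fst.comp hc)))
  have hc₂ := snd.comp (snd.comp (snd.comp (fst.comp hc)))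
  have hβ := fst.comp (snd.comp hc)
  have hd := fst.comp (snd.comp (snd.comp hc))
  have hs₀ := fst.comp (snd.comp (snd.comp (snd.comp hc)))
  have hs₁ := fst.comp (snd.comp (snd.comp (snd.comp (snd.comp hc))))
  have hs₂ := snd.comp (snd.comp (snd.comp (snd.comp (snd.comp hc))))
  have haa := intTable_mul hm ha ha
  have h1 := (PrimrecPred.ne hn (const 0)).and (PrimrecPred.forall_fin fun i : Fin 9 =>
    Primrec.eq.comp (intTable_mul hm hu (const (Pi.single i 1 : IntVector)))
      (int_smul hn (const (Pi.single i 1 : IntVector))))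
  have h2 := (Primrec.eq.comp (int_smul hn (intTable_mul hm ha haa))
    (int_vec_add (int_vec_add (int_smul hc₀ hu) (int_smul (int_mul hn hc₁) ha))
      (int_smul (int_mul hn hc₂) haa))).and (PrimrecPred.hasNoSmallRoot hc₀ hc₁ hc₂)
  have h3 := (PrimrecPred.ne hβ (const 0)).and (Primrec.eq.comp
    (int_smul hn (intTable_mul hm hb (intTable_mul hm hb hb))) (int_smul hβ hu))
  have h4 := (PrimrecPred.ne (intTable_mul hm hb ha) (intTable_mul hm ha hb)).and
    ((PrimrecPred.ne hd (const 0)).and (Primrec.eq.comp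
      (int_smul (int_mul hn hd) (intTable_mul hm hb ha))
      (intTable_mul hm (int_vec_add (int_vec_add (int_smul hs₀ hu)
        (int_smul (int_mul hn hs₁) ha)) (int_smul (int_mul hn hs₂) haa)) hb)))
  exact (h1.and (h2.and (h3.and h4))).of_eq fun w => Iff.rfl

theorem Primrec.scaledName {D : α → ℤ} {x : α → IntVector} (hD : Primrec D) (hx : Primrec x) :
    Primrec fun w => scaledName (D w) (x w) :=
  fin_pi fun i => Primrec.pair (int_mul hD (fin_apply hx i)) (const 1)

/-- The case distinctions are classical in form, but their conditions are primitive recursive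
predicates. -/
theorem Primrec.certificate_output : Primrec₂ Certificate.output := by
  classical
  have ht : Primrec fun p : StructureTable × Certificate => p.1 := fst
  have hD : Primrec fun p : StructureTable × Certificate => p.2.1.1 := fst.comp (fst.comp snd)
  have hm : Primrec fun p : StructureTable × Certificate => p.2.1.2 := snd.comp (fst.comp snd)
  have ha : Primrec fun p : StructureTable × Certificate => p.2.2.1.1 :=
    fst.comp (fst.comp (snd.comp snd))
  have hb : Primrec fun p : StructureTable × Certificate => p.2.2.1.2.1 :=
    fst.comp (snd.comp (fst.comp (snd.comp snd)))
  have hu : Primrec fun p : StructureTable × Certificate => p.2.2.1.2.2 :=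
    snd.comp (snd.comp (fst.comp (snd.comp snd)))
  have hc : Primrec fun p : StructureTable × Certificate => p.2.2.2 := snd.comp (snd.comp snd)
  have hsc := PrimrecPred.isScaledTable ht hD hm
  exact Primrec.ite (hsc.and (PrimrecPred.isZeroDivisorPair hm ha hb))
    (option_some.comp (sumInl.comp (Primrec.scaledName hD ha)))
    (Primrec.ite (hsc.and (PrimrecPred.isCyclicCertificate hm ha hb hu hc))
      (option_some.comp (sumInr.comp
        (Primrec.pair (Primrec.scaledName hD ha) (Primrec.scaledName hD hb))))
      (const none))

theorem partrec_searchCertificate : Partrec searchCertificate := by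
  have h : Primrec₂ fun (p : StructureTable × ℕ) (w : Certificate) => Certificate.output p.1 w :=
    Primrec.certificate_output.comp₂ (fst.comp fst).to₂ snd.to₂
  have hd : Primrec fun p : StructureTable × ℕ => decodeCertificate p.2 :=
    (Primrec.decode (α := Certificate)).comp snd
  exact Partrec.rfindOpt (Primrec.option_bind hd h).to_comp.to₂

end Computability

/-! ### Soundness and completeness of certificates -/

section Coordinates

variable {A : Type u} [Ring A] [Algebra ℚ A]

/-- The element of `A` with integral coordinates with respect to the multiple `D • e` of a
basis. -/
noncomputable def elementOfVector (e : Module.Basis (Fin 9) ℚ A) (D : ℤ) : IntVector →ₗ[ℤ] A :=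
  Fintype.linearCombination ℤ fun i => (D : ℚ) • e i

variable (e : Module.Basis (Fin 9) ℚ A) {D : ℤ} {m : IntTable}

theorem elementOfVector_apply (x : IntVector) :
    elementOfVector e D x = ∑ i, ((D : ℚ) * x i) • e i := by
  simp only [elementOfVector, Fintype.linearCombination_apply]
  refine Finset.sum_congr rfl fun i _ => ?_
  rw [← Int.cast_smul_eq_zsmul ℚ, smul_smul, mul_comm]

theorem elementOfName_scaledName (x : IntVector) :
    elementOfName e (scaledName D x) = elementOfVector e D x := by
  rw [elementOfVector_apply]
  refine Finset.sum_congr rfl fun i _ => ?_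
  simp [scaledName, ratOfName]

theorem elementOfVector_single (i : Fin 9) :
    elementOfVector e D (Pi.single i 1) = (D : ℚ) • e i := by
  simp [elementOfVector, Fintype.linearCombination_apply_single]

theorem elementOfVector_smul (c : ℤ) (x : IntVector) :
    elementOfVector e D (c • x) = (c : ℚ) • elementOfVector e D x := by
  rw [map_smul, Int.cast_smul_eq_zsmul]

theorem elementOfVector_injective (hD : D ≠ 0) : Function.Injective (elementOfVector e D) := by
  rw [injective_iff_map_eq_zero]
  intro x hx
  rw [elementOfVector_apply] at hx
  have h := Fintype.linearIndependent_iff.1 e.linearIndependent _ hx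
  funext i
  simpa [hD] using h i

/-- Since `(D eᵢ)(D eⱼ) = ∑ (D cᵢⱼₖ)(D eₖ)`, the scaled basis has structure constants `D cᵢⱼₖ`. -/
theorem elementOfVector_mul (h : IsScaledTable (structureTable e) D m) (x y : IntVector) :
    elementOfVector e D (m.mul x y) = elementOfVector e D x * elementOfVector e D y := by
  have hm : ∀ i j k, (m i j k : ℚ) = D * e.repr (e i * e j) k := by
    intro i j k
    have h1 : (m i j k : ℚ) * ((e.repr (e i * e j) k).den : ℚ) =
        D * ((e.repr (e i * e j) k).num : ℚ) := by
      have := h.2 i j k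
      simp only [structureTable, ratName] at this
      exact_mod_cast this
    have hden : ((e.repr (e i * e j) k).den : ℚ) ≠ 0 := by
      exact_mod_cast (e.repr (e i * e j) k).den_nz
    refine mul_right_cancel₀ hden ?_
    rw [h1, mul_assoc, Rat.mul_den_eq_num]
  apply e.repr.injective
  ext k
  simp only [elementOfVector_apply, Finset.sum_mul, Finset.mul_sum, smul_mul_smul_comm, map_sum,
    map_smul, Finsupp.coe_finsetSum, Finset.sum_apply, Finsupp.smul_apply, smul_eq_mul,
    e.repr_self, Finsupp.single_apply, mul_ite, mul_one, mul_zero, Finset.sum_ite_eq',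
    Finset.mem_univ, if_true]
  simp only [IntTable.mul, Int.cast_sum, Int.cast_mul, hm, Finset.mul_sum]
  rw [Finset.sum_comm]
  refine Finset.sum_congr rfl fun i _ => Finset.sum_congr rfl fun j _ => ?_
  ring

theorem isZeroDivisor_of_isZeroDivisorPair (h : IsScaledTable (structureTable e) D m)
    {x y : IntVector} (hxy : m.IsZeroDivisorPair x y) : IsZeroDivisor (elementOfVector e D x) := by
  obtain ⟨hx, hy, h0⟩ := hxy
  have hinj := elementOfVector_injective e h.1
  refine ⟨(map_ne_zero_iff _ hinj).2 hx, fun hmem => ?_⟩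
  have := elementOfVector_mul e h x y
  rw [h0, map_zero] at this
  exact (map_ne_zero_iff _ hinj).2 hy (hmem.1 _ this.symm)

end Coordinates

/-! ### Irreducibility of monic integral cubics by a finite root test. -/

section Cubic

open Polynomial

theorem HasNoSmallRoot.cubicValue_ne_zero {c₀ c₁ c₂ : ℤ} (h : HasNoSmallRoot c₀ c₁ c₂) (z : ℤ) :
    cubicValue c₀ c₁ c₂ z ≠ 0 := by
  intro hz
  have hc₀ : c₀ ≠ 0 := by
    rintro rfl
    exact (h 0 (by simp)).1 (by simp [cubicValue])
  -- An integral root divides the constant term, which is nonzero because 0 is among the tested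
  -- values; hence its absolute value is in the tested range.
  have hdvd : z ∣ c₀ := ⟨z * z - c₂ * z - c₁, by unfold cubicValue at hz; linarith⟩
  have hle := Nat.le_of_dvd (Int.natAbs_pos.2 hc₀) (Int.natAbs_dvd_natAbs.2 hdvd)
  obtain ⟨h1, h2⟩ := h z.natAbs (List.mem_range.2 (by omega))
  rcases Int.natAbs_eq z with hz' | hz'
  · exact h1 (by rw [← hz']; exact hz)
  · exact h2 (by rw [← hz']; exact hz)

/-- The monic cubic polynomial whose value at an integer is `cubicValue`. -/
noncomputable def cubicPolynomial (c₀ c₁ c₂ : ℤ) : ℤ[X] :=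
  X ^ 3 - C c₂ * X ^ 2 - C c₁ * X - C c₀

theorem natDegree_cubicPolynomial (c₀ c₁ c₂ : ℤ) : (cubicPolynomial c₀ c₁ c₂).natDegree = 3 := by
  unfold cubicPolynomial
  compute_degree!

theorem monic_cubicPolynomial (c₀ c₁ c₂ : ℤ) : (cubicPolynomial c₀ c₁ c₂).Monic := by
  unfold cubicPolynomial
  monicity!

theorem HasNoSmallRoot.irreducible {c₀ c₁ c₂ : ℤ} (h : HasNoSmallRoot c₀ c₁ c₂) :
    Irreducible ((cubicPolynomial c₀ c₁ c₂).map (Int.castRingHom ℚ)) := by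
  have hmon := monic_cubicPolynomial c₀ c₁ c₂
  refine irreducible_of_degree_le_three_of_not_isRoot ?_ fun r hr => ?_
  · rw [hmon.natDegree_map, natDegree_cubicPolynomial]
    simp
  · have hint : IsIntegral ℤ r := ⟨_, hmon, by rwa [IsRoot, eval_map] at hr⟩
    obtain ⟨z, rfl⟩ := IsIntegrallyClosed.isIntegral_iff.1 hint
    refine h.cubicValue_ne_zero z ?_
    simp [cubicPolynomial] at hr
    unfold cubicValue
    have : (z : ℚ) ^ 3 - c₂ * z ^ 2 - c₁ * z - c₀ = 0 := hr
    have h2 : z ^ 3 - c₂ * z ^ 2 - c₁ * z - c₀ = 0 := by exact_mod_cast this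
    linarith

theorem hasNoSmallRoot_of_forall {c₀ c₁ c₂ : ℤ}
    (h : ∀ r : ℚ, r ^ 3 ≠ c₀ + c₁ * r + c₂ * r ^ 2) : HasNoSmallRoot c₀ c₁ c₂ := by
  have key : ∀ z : ℤ, cubicValue c₀ c₁ c₂ z ≠ 0 := by
    intro z hz
    refine h z ?_
    unfold cubicValue at hz
    have : z ^ 3 = c₀ + c₁ * z + c₂ * z ^ 2 := by linarith
    exact_mod_cast this
  exact fun n _ => ⟨key n, key (-n)⟩

end Cubic

/-! ### Soundness and existence of certificates. -/

section Certificates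

variable {A : Type u} [Ring A] [Algebra ℚ A] (e : Module.Basis (Fin 9) ℚ A) {D : ℤ}
  {m : IntTable}

theorem generatesAsCyclicAlgebra_of_isCyclicCertificate
    (h : IsScaledTable (structureTable e) D m) {a b u : IntVector} {c : CyclicCoefficients}
    (hc : m.IsCyclicCertificate a b u c) :
    GeneratesAsCyclicAlgebra (elementOfVector e D a) (elementOfVector e D b) := by
  obtain ⟨⟨n, c₀, c₁, c₂⟩, β, d, s₀, s₁, s₂⟩ := c
  obtain ⟨⟨hn, hu⟩, ⟨ha, hroot⟩, ⟨hβ, hb⟩, hba, hd, hs⟩ := hc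
  have hn' : (n : ℚ) ≠ 0 := by exact_mod_cast hn
  have hd' : (d : ℚ) ≠ 0 := by exact_mod_cast hd
  have hD' : (D : ℚ) ≠ 0 := by exact_mod_cast h.1
  have hβ' : (β : ℚ) ≠ 0 := by exact_mod_cast hβ
  have hmul := elementOfVector_mul e h
  have hinj := elementOfVector_injective e h.1
  have hu1 : elementOfVector e D u = (n : ℚ) • 1 := by
    -- The certificate only tests `u` against basis vectors; linearity extends this to all of `A`,
    -- and evaluation at `1` identifies `u`.
    have hlin : LinearMap.mulLeft ℚ (elementOfVector e D u) = (n : ℚ) • LinearMap.id := by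
      refine e.ext fun i => ?_
      have h1 := congrArg (elementOfVector e D) (hu i)
      rw [hmul, elementOfVector_smul, elementOfVector_single, mul_smul_comm, smul_comm] at h1
      simpa using smul_right_injective A hD' h1
    simpa using LinearMap.congr_fun hlin 1
  have ha' := congrArg (elementOfVector e D) ha
  have hb' := congrArg (elementOfVector e D) hb
  have hs' := congrArg (elementOfVector e D) hs
  simp only [hmul, elementOfVector_smul, map_add, hu1] at ha' hb' hs'
  have hba' : elementOfVector e D b * elementOfVector e D a ≠
      elementOfVector e D a * elementOfVector e D b := by
    rw [← hmul, ← hmul]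
    exact hinj.ne hba
  generalize elementOfVector e D a = x at *
  generalize elementOfVector e D b = y at *
  have hA : Module.finrank ℚ A = 9 := by rw [Module.finrank_eq_card_basis e, Fintype.card_fin]
  refine generatesAsCyclicAlgebra_of_relations hA (f := (cubicPolynomial c₀ c₁ c₂).map
    (Int.castRingHom ℚ)) hroot.irreducible ?_ ?_ hba' (β := β) hβ' ?_
    (s₀ := s₀ / d) (s₁ := s₁ / d) (s₂ := s₂ / d) ?_
  · rw [(monic_cubicPolynomial c₀ c₁ c₂).natDegree_map, natDegree_cubicPolynomial]
  · have h3 : x ^ 3 = (c₀ : ℚ) • 1 + (c₁ : ℚ) • x + (c₂ : ℚ) • x ^ 2 := by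
      refine smul_right_injective A hn' ?_
      simp only [pow_succ, pow_zero, one_mul, mul_assoc]
      rw [ha']
      push_cast
      module
    simp only [cubicPolynomial, Polynomial.map_sub, Polynomial.map_mul, Polynomial.map_pow,
      Polynomial.map_X, Polynomial.map_C, map_sub, map_mul, map_pow, Polynomial.aeval_X,
      Polynomial.aeval_C, h3]
    simp only [Algebra.algebraMap_eq_smul_one, smul_mul_assoc, one_mul, eq_intCast]
    module
  · refine smul_right_injective A hn' ?_
    simp only [pow_succ, pow_zero, one_mul, mul_assoc]
    rw [hb', smul_comm]
  · refine smul_right_injective A (mul_ne_zero hn' hd') ?_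
    dsimp only
    push_cast at hs'
    rw [hs', ← smul_mul_assoc ((n : ℚ) * d), sq]
    refine congrArg (· * y) ?_
    match_scalars <;> field_simp

/-- Finitely many rational numbers have a common denominator. -/
theorem exists_common_denominator {ι : Type*} [Finite ι] (f : ι → ℚ) :
    ∃ (N : ℤ) (g : ι → ℤ), N ≠ 0 ∧ ∀ i, (g i : ℚ) = N * f i := by
  obtain ⟨N, hN⟩ := IsLocalization.exist_integer_multiples_of_finite (nonZeroDivisors ℤ) f
  choose g hg using hN
  exact ⟨N, g, nonZeroDivisors.ne_zero N.2, fun i => by simpa using hg i⟩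

theorem exists_isScaledTable :
    ∃ (D : ℤ) (m : IntTable), IsScaledTable (structureTable e) D m := by
  obtain ⟨D, g, hD, hg⟩ := exists_common_denominator
    fun p : Fin 9 × Fin 9 × Fin 9 => e.repr (e p.1 * e p.2.1) p.2.2
  refine ⟨D, fun i j k => g (i, j, k), hD, fun i j k => ?_⟩
  have h := hg (i, j, k)
  dsimp only at h
  have h2 : (g (i, j, k) : ℚ) * (e.repr (e i * e j) k).den =
      D * (e.repr (e i * e j) k).num := by
    rw [h, mul_assoc, Rat.mul_den_eq_num]
  exact_mod_cast h2

theorem elementOfVector_eq_smul (hD : D ≠ 0) {N : ℤ} {x : IntVector} {y : A}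
    (h : ∀ i, (x i : ℚ) = N * (e.repr y i / D)) : elementOfVector e D x = (N : ℚ) • y := by
  have hD' : (D : ℚ) ≠ 0 := by exact_mod_cast hD
  conv_rhs => rw [← e.sum_repr y, Finset.smul_sum]
  rw [elementOfVector_apply]
  refine Finset.sum_congr rfl fun i _ => ?_
  rw [h, smul_smul]
  congr 1
  field_simp

theorem exists_elementOfVector_eq_smul {ι : Type*} [Finite ι] (hD : D ≠ 0) (y : A)
    (f : ι → ℚ) :
    ∃ (N : ℤ) (x : IntVector) (g : ι → ℤ), N ≠ 0 ∧ elementOfVector e D x = (N : ℚ) • y ∧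
      ∀ i, (g i : ℚ) = N * f i := by
  obtain ⟨N, g, hN, hg⟩ := exists_common_denominator (Sum.elim (fun i => e.repr y i / D) f)
  exact ⟨N, g ∘ Sum.inl, g ∘ Sum.inr, hN,
    elementOfVector_eq_smul e hD fun i => hg (Sum.inl i), fun i => hg (Sum.inr i)⟩

theorem exists_isZeroDivisorPair (h : IsScaledTable (structureTable e) D m)
    (hA : ¬ NoZeroDivisors A) : ∃ x y, m.IsZeroDivisorPair x y := by
  have h0 : ∃ x y : A, x * y = 0 ∧ x ≠ 0 ∧ y ≠ 0 := by
    by_contra! hcon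
    exact hA ⟨fun {x y} hxy => or_iff_not_imp_left.2 fun hx => hcon x y hxy hx⟩
  obtain ⟨x, y, hxy, hx, hy⟩ := h0
  obtain ⟨N, v, -, hN, hv, -⟩ := exists_elementOfVector_eq_smul e h.1 x (Empty.elim : Empty → ℚ)
  obtain ⟨M, w, -, hM, hw, -⟩ := exists_elementOfVector_eq_smul e h.1 y (Empty.elim : Empty → ℚ)
  have hinj := elementOfVector_injective e h.1
  refine ⟨v, w, ?_, ?_, hinj ?_⟩
  · rw [← map_ne_zero_iff _ hinj, hv]
    exact smul_ne_zero (by exact_mod_cast hN) hx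
  · rw [← map_ne_zero_iff _ hinj, hw]
    exact smul_ne_zero (by exact_mod_cast hM) hy
  · rw [elementOfVector_mul e h, hv, hw, smul_mul_smul_comm, hxy, smul_zero, map_zero]

/-- Division of the cubic by `X - r`. In a division algebra a rational root would thus give a linear
or quadratic relation for `a`. -/
theorem sub_mul_sq_sub_eq_zero {F A : Type*} [Field F] [Ring A] [Algebra F A] {a : A}
    {c₀ c₁ c₂ r : F} (hc : a ^ 3 = c₀ • 1 + c₁ • a + c₂ • a ^ 2)
    (hr : r ^ 3 = c₀ + c₁ * r + c₂ * r ^ 2) :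
    (a - r • 1) * (a ^ 2 - ((c₁ + c₂ * r - r ^ 2) • 1 + (c₂ - r) • a)) = 0 := by
  have : (a - r • 1) * (a ^ 2 - ((c₁ + c₂ * r - r ^ 2) • 1 + (c₂ - r) • a)) =
      a ^ 3 - c₂ • a ^ 2 - c₁ • a + (c₁ * r + c₂ * r ^ 2 - r ^ 3) • 1 := by
    simp only [pow_succ, pow_zero, one_mul, sub_mul, mul_sub, mul_add, smul_mul_assoc,
      mul_smul_comm, mul_one, mul_assoc]
    module
  rw [this, hc, hr]
  module

theorem exists_generators_with_relations {A : Type*} [Ring A] [Nontrivial A] [NoZeroDivisors A]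
    [Algebra ℚ A] [Algebra.IsCentral ℚ A] (hA : Module.finrank ℚ A = 9) :
    ∃ (a b : A) (c₀ c₁ c₂ β s₀ s₁ s₂ : ℚ), a ^ 3 = c₀ • 1 + c₁ • a + c₂ • a ^ 2 ∧
      (∀ r : ℚ, r ^ 3 ≠ c₀ + c₁ * r + c₂ * r ^ 2) ∧ b * a ≠ a * b ∧ β ≠ 0 ∧ b ^ 3 = β • 1 ∧
      b * a = (s₀ • 1 + s₁ • a + s₂ • a ^ 2) * b := by
  have : IsDomain A := NoZeroDivisors.to_isDomain A
  have : FiniteDimensional ℚ A := .of_finrank_pos (by omega)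
  let := divisionRingOfFiniteDimensional ℚ A
  obtain ⟨a, b, ha, hba, ⟨β, hβ, hb⟩, s₀, s₁, s₂, hs⟩ :=
    exists_cyclic_generators (F := ℚ) (D := A) hA fun c => by nlinarith [sq_nonneg (2 * c + 1)]
  obtain ⟨c₀, c₁, c₂, hc⟩ := exists_cubic hA ha
  refine ⟨a, b, c₀, c₁, c₂, β, s₀, s₁, s₂, hc, fun r hr => ?_, hba, hβ, hb, hs⟩
  have hprod := sub_mul_sq_sub_eq_zero hc hr
  rcases mul_eq_zero.1 hprod with h | h
  · refine ha (Algebra.mem_bot.2 ⟨r, ?_⟩)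
    rw [Algebra.algebraMap_eq_smul_one, ← sub_eq_zero.1 h]
  · exact sq_ne_of_notMem_bot hA ha _ _ (sub_eq_zero.1 h)

theorem exists_isCyclicCertificate [Nontrivial A] [NoZeroDivisors A] [Algebra.IsCentral ℚ A]
    (h : IsScaledTable (structureTable e) D m) :
    ∃ a b u c, m.IsCyclicCertificate a b u c := by
  have hA : Module.finrank ℚ A = 9 := by rw [Module.finrank_eq_card_basis e, Fintype.card_fin]
  obtain ⟨a, b, c₀, c₁, c₂, β, s₀, s₁, s₂, hc, hr, hba, hβ, hb, hs⟩ :=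
    exists_generators_with_relations hA
  obtain ⟨n, u, -, hn, hu, -⟩ := exists_elementOfVector_eq_smul e h.1 (1 : A)
    (Empty.elim : Empty → ℚ)
  obtain ⟨N, v, g, hN, hv, hg⟩ := exists_elementOfVector_eq_smul e h.1 a ![c₀, c₁, c₂]
  obtain ⟨M, w, γ, hM, hw, hγ⟩ := exists_elementOfVector_eq_smul e h.1 b ![β]
  have hn' : (n : ℚ) ≠ 0 := by exact_mod_cast hn
  have hN' : (N : ℚ) ≠ 0 := by exact_mod_cast hN
  have hM' : (M : ℚ) ≠ 0 := by exact_mod_cast hM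
  -- For the generators `N a` and `M b`, the polynomial expressing the conjugate of `N a` has
  -- coefficients `N s₀`, `s₁`, `s₂ / N`.
  obtain ⟨d, t, hd, ht⟩ := exists_common_denominator ![N * s₀, s₁, s₂ / N]
  have hd' : (d : ℚ) ≠ 0 := by exact_mod_cast hd
  have hmul := elementOfVector_mul e h
  have hinj := elementOfVector_injective e h.1
  have hg0 : (g 0 : ℚ) = N * c₀ := hg 0
  have hg1 : (g 1 : ℚ) = N * c₁ := hg 1
  have hg2 : (g 2 : ℚ) = N * c₂ := hg 2
  have hγ0 : (γ 0 : ℚ) = M * β := hγ 0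
  have ht0 : (t 0 : ℚ) = d * (N * s₀) := ht 0
  have ht1 : (t 1 : ℚ) = d * s₁ := ht 1
  have ht2 : (t 2 : ℚ) = d * (s₂ / N) := ht 2
  -- The cubic of `N a` has coefficients `N³c₀`, `N²c₁`, `N c₂`, and `(M b)³ = M³β`; one factor `N`
  -- or `M` is already absorbed in `g` and `γ`.
  refine ⟨v, w, u, ((n, N ^ 2 * g 0, N * g 1, g 2), (M ^ 2 * γ 0, d, t 0, t 1, t 2)),
    ⟨hn, fun i => hinj ?_⟩, ⟨hinj ?_, hasNoSmallRoot_of_forall fun r hr' => ?_⟩,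
    ⟨?_, hinj ?_⟩, fun hcomm => hba ?_, hd, hinj ?_⟩
  · rw [hmul, hu, smul_mul_assoc, one_mul, elementOfVector_smul]
  · simp only [map_add, elementOfVector_smul, hmul, hu, hv, smul_mul_smul_comm]
    push_cast
    rw [hg0, hg1, hg2, ← sq a, ← pow_succ' a 2, hc]
    module
  · push_cast at hr'
    rw [hg0, hg1, hg2] at hr'
    refine hr (r / N) ?_
    field_simp
    linear_combination hr'
  · have : ((M ^ 2 * γ 0 : ℤ) : ℚ) ≠ 0 := by
      push_cast
      rw [hγ0]
      positivity
    exact_mod_cast this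
  · simp only [elementOfVector_smul, hmul, hu, hw, smul_mul_smul_comm]
    push_cast
    rw [hγ0, ← sq b, ← pow_succ' b 2, hb]
    module
  · have h1 := congrArg (elementOfVector e D) hcomm
    rw [hmul, hmul, hv, hw, smul_mul_smul_comm, smul_mul_smul_comm, mul_comm (M : ℚ)] at h1
    exact smul_right_injective A (mul_ne_zero hN' hM') h1
  · simp only [map_add, elementOfVector_smul, hmul, hu, hv, hw, smul_mul_smul_comm]
    push_cast
    rw [ht0, ht1, ht2, hs]
    simp only [add_mul, smul_mul_assoc, mul_smul_comm, one_mul, sq, mul_assoc]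
    match_scalars <;> field_simp

end Certificates

theorem exists_decodeCertificate_eq (w : Certificate) : ∃ n, decodeCertificate n = some w :=
  ⟨_, @Encodable.encodek Certificate Primcodable.toEncodable w⟩

/-- There is one algorithm (a partial recursive function) which, given the multiplication table of
any central simple `ℚ`-algebra `A` of degree 3 (that is, of dimension 9) in any basis, terminates
and returns either a zero divisor of `A` or elements `a, b` generating `A` as a cyclic algebra. -/
theorem mainTheorem6 :
    ∃ find : StructureTable →. SearchOutput, Partrec find ∧
      ∀ (A : Type u) [Ring A] [Algebra ℚ A] [Algebra.IsCentral ℚ A] [IsSimpleRing A]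
        (_hdeg : Module.finrank ℚ A = 3 ^ 2) (e : Module.Basis (Fin 9) ℚ A),
        ∃ out ∈ find (structureTable e), SearchOutput.IsCorrect e out := by
  refine ⟨searchCertificate, partrec_searchCertificate, ?_⟩
  intro A _ _ _ _ _ e
  have hdom : (searchCertificate (structureTable e)).Dom := by
    refine Nat.rfindOpt_dom.2 ?_
    obtain ⟨D, m, h⟩ := exists_isScaledTable e
    obtain ⟨w, hw⟩ : ∃ w : Certificate, ∃ out, w.output (structureTable e) = some out := by
      by_cases hA : NoZeroDivisors A
      · obtain ⟨a, b, u, c, hc⟩ := exists_isCyclicCertificate e h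
        refine ⟨((D, m), (a, b, u), c), ?_⟩
        unfold Certificate.output
        split_ifs with h1 h2
        · exact ⟨_, rfl⟩
        · exact ⟨_, rfl⟩
        · exact absurd ⟨h, hc⟩ h2
      · obtain ⟨x, y, hxy⟩ := exists_isZeroDivisorPair e h hA
        -- The zero entries are placeholders that the zero divisor test does not read.
        refine ⟨((D, m), (x, y, 0), 0), ?_⟩
        exact ⟨_, if_pos ⟨h, hxy⟩⟩
    obtain ⟨out, hout⟩ := hw
    obtain ⟨n, hn⟩ := exists_decodeCertificate_eq w
    exact ⟨n, out, by rw [hn]; exact hout⟩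
  obtain ⟨n, hn⟩ := Nat.rfindOpt_spec (Part.get_mem hdom)
  refine ⟨_, Part.get_mem hdom, ?_⟩
  obtain ⟨w, -, hw⟩ := Option.bind_eq_some_iff.1 hn
  unfold Certificate.output at hw
  split_ifs at hw with h1 h2
  · rw [← Option.some.inj hw]
    change IsZeroDivisor (elementOfName e _)
    rw [elementOfName_scaledName]
    exact isZeroDivisor_of_isZeroDivisorPair e h1.1 h1.2
  · rw [← Option.some.inj hw]
    change GeneratesAsCyclicAlgebra (elementOfName e _) (elementOfName e _)
    rw [elementOfName_scaledName, elementOfName_scaledName]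
    exact generatesAsCyclicAlgebra_of_isCyclicCertificate e h2.1 h2.2
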